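/- For a partition $\lambda$ let $f^\lambda$ be the number of standard Young tableaux of shape $\lambda$ (with $f^\emptyset=1$), and for integers $N,k\ge 0$ let $\Lambda_N^k=\{\lambda\vdash N:\ \lambda_1\ge N-k\}$, where $\lambda_1=0$ for the empty partition. For integers $n\ge 1$ and $k\ge 0$, an $n$-vacillating tableau of shape $\lambda$ and length $2k+1$ is a sequence of $2k+2$ integer partitions $$\big((n)=\lambda^{(0)},\lambda^{(\frac12)},\lambda^{(1)},\lambda^{(1\frac12)},\dots,\lambda^{(k)},\lambda^{(k+\frac12)}=\lambda\big)$$ such that, identifying partitions with their Young diagrams, $\lambda^{(j)}\supseteq\lambda^{(j+\frac12)}$ and $|\lambda^{(j)}/\lambda^{(j+\frac12)}|=1$ for $0\le j\le k$, and $\lambda^{(j+\frac12)}\subseteq\lambda^{(j+1)}$ and $|\lambda^{(j+1)}/\lambda^{(j+\frac12)}|=1$ for $0\le j\le k-1$. Let $m_{n,k+\frac12}^\lambda$ be the number of such sequences. Then for all integers $n\ge 1$ and $k\ge 0$, $$n^k=\sum_{\lambda\in\Lambda_{n-1}^k} f^\lambda\, m_{n,k+\frac12}^\lambda .$$ -/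

import Mathlib

namespace Vacillating

/-- The number of boxes of the skew shape `μ / ν` (used when `ν ⊆ μ`). -/
def skewCard (μ ν : YoungDiagram) : ℕ := (μ.cells \ ν.cells).card

theorem finite_card_le (N : ℕ) : {μ : YoungDiagram | μ.card ≤ N}.Finite := by
  refine Set.Finite.of_finite_image (f := YoungDiagram.cells)
    (((Finset.range N ×ˢ Finset.range N).powerset.finite_toSet).subset ?_)
    (fun a _ b _ h => YoungDiagram.ext h)
  rintro _ ⟨μ, hμ, rfl⟩
  simp only [Finset.coe_powerset, Set.mem_preimage, Set.mem_powerset_iff, Finset.coe_subset]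
  rintro ⟨i, j⟩ hij
  have hij' : (i, j) ∈ μ := hij
  have h1 : j < μ.rowLen i := YoungDiagram.mem_iff_lt_rowLen.1 hij'
  have h2 : i < μ.colLen j := YoungDiagram.mem_iff_lt_colLen.1 hij'
  have h3 : μ.rowLen i ≤ μ.card := by
    rw [YoungDiagram.rowLen_eq_card]
    exact Finset.card_le_card (Finset.filter_subset _ _)
  have h4 : μ.colLen j ≤ μ.card := by
    rw [YoungDiagram.colLen_eq_card]
    exact Finset.card_le_card (Finset.filter_subset _ _)
  have h5 : μ.card ≤ N := hμ
  simp only [Finset.mem_product, Finset.mem_range]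
  omega

/-- The set `Λ_N^k` of the partitions `μ` of `N` with first part `μ₁ ≥ N - k`. -/
def shapeSet (N k : ℕ) : Set YoungDiagram :=
  {μ | μ.card = N ∧ (N : ℤ) - (k : ℤ) ≤ (μ.rowLen 0 : ℤ)}

theorem shapeSet_finite (N k : ℕ) : (shapeSet N k).Finite :=
  (finite_card_le N).subset fun _ h => h.1.le

/-- `Λ_N^k` as a finite set. -/
noncomputable def shapes (N k : ℕ) : Finset YoungDiagram := (shapeSet_finite N k).toFinset

/-- A semistandard Young tableau is standard if its content (the multiset of its entries) is
`{1, …, |μ|}`. -/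
def IsStandard {μ : YoungDiagram} (T : SemistandardYoungTableau μ) : Prop :=
  μ.cells.val.map (fun c => T c.1 c.2) = (Finset.Icc 1 μ.card).val

/-- The standard Young tableaux of shape `μ`. -/
abbrev SYT (μ : YoungDiagram) : Type := {T : SemistandardYoungTableau μ // IsStandard T}

instance (μ : YoungDiagram) : Finite (SYT μ) := by
  have key : ∀ (T : SYT μ) (c : μ.cells), T.1 c.1.1 c.1.2 < μ.card + 1 := by
    intro T c
    have h : T.1 c.1.1 c.1.2 ∈ μ.cells.val.map (fun c => T.1 c.1 c.2) :=
      Multiset.mem_map.2 ⟨c.1, c.2, rfl⟩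
    rw [show μ.cells.val.map (fun c => T.1 c.1 c.2) = _ from T.2] at h
    have h' : T.1 c.1.1 c.1.2 ∈ Finset.Icc 1 μ.card := h
    rw [Finset.mem_Icc] at h'
    omega
  refine Finite.of_injective
    (fun (T : SYT μ) (c : μ.cells) => (⟨T.1 c.1.1 c.1.2, key T c⟩ : Fin (μ.card + 1))) ?_
  intro T T' h
  apply Subtype.ext
  ext i j
  by_cases hij : (i, j) ∈ μ
  · have := congrFun h ⟨(i, j), hij⟩
    simpa using this
  · rw [T.1.zeros hij, T'.1.zeros hij]

/-- `f^μ`, the number of standard Young tableaux of shape `μ`. -/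
noncomputable def numSYT (μ : YoungDiagram) : ℕ := Nat.card (SYT μ)

/-- The one-row partition `(n)`. -/
def oneRow (n : ℕ) : YoungDiagram := YoungDiagram.ofRowLens [n] (List.pairwise_singleton _ _).sortedGE

/-- An `n`-vacillating tableau of shape `μ` and length `L`: a walk `shape 0, …, shape L` from `(n)`
to `μ` that alternately removes one box and adds one box, beginning with a removal. The partition
`shape i` is the one that is traditionally indexed by the half-integer `i / 2`. -/
@[ext]
structure VacTableau (n L : ℕ) (μ : YoungDiagram) where
  shape : Fin (L + 1) → YoungDiagram
  first : shape 0 = oneRow n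
  final : shape (Fin.last L) = μ
  remove : ∀ i : Fin L, Even (i : ℕ) →
    shape i.succ ≤ shape i.castSucc ∧ skewCard (shape i.castSucc) (shape i.succ) = 1
  insert : ∀ i : Fin L, Odd (i : ℕ) →
    shape i.castSucc ≤ shape i.succ ∧ skewCard (shape i.succ) (shape i.castSucc) = 1

instance (n L : ℕ) (μ : YoungDiagram) : Finite (VacTableau n L μ) := by
  have key : ∀ (P : VacTableau n L μ) (i : Fin (L + 1)),
      (P.shape i).card ≤ (oneRow n).card + i := by
    intro P i
    induction i using Fin.induction with
    | zero => simp [P.first]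
    | succ i ih =>
      rcases Nat.even_or_odd (i : ℕ) with h | h
      · have h1 : (P.shape i.succ).card ≤ (P.shape i.castSucc).card :=
          Finset.card_le_card (P.remove i h).1
        simp only [Fin.val_castSucc, Fin.val_succ] at ih ⊢
        omega
      · have h1 : (P.shape i.succ).card ≤ (P.shape i.castSucc).card +
            skewCard (P.shape i.succ) (P.shape i.castSucc) := by
          have := Finset.card_le_card_sdiff_add_card (s := (P.shape i.succ).cells)
            (t := (P.shape i.castSucc).cells)
          simp only [skewCard, YoungDiagram.card]
          omega
        rw [(P.insert i h).2] at h1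
        simp only [Fin.val_castSucc, Fin.val_succ] at ih ⊢
        omega
  have : Finite {ν : YoungDiagram | ν.card ≤ (oneRow n).card + L} := finite_card_le _
  refine Finite.of_injective (fun (P : VacTableau n L μ) (i : Fin (L + 1)) =>
    (⟨P.shape i, (key P i).trans (by have := i.2; omega)⟩ :
      {ν : YoungDiagram | ν.card ≤ (oneRow n).card + L})) ?_
  intro P P' h
  ext1
  funext i
  simpa using congrFun h i

/-- The number of `n`-vacillating tableaux of shape `μ` and length `L`: this is `m_{n,k}^μ` for
`L = 2k` and `m_{n,k+1/2}^μ` for `L = 2k+1`. -/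
noncomputable def numVac (n L : ℕ) (μ : YoungDiagram) : ℕ := Nat.card (VacTableau n L μ)

end Vacillating

/-! Weight each shape by `f` and follow `∑ f^λ m^λ` along the walk. A removal step preserves this
sum, by the branching rule `f^ν = ∑ f^κ` over the `κ` covered by `ν` (`numSYT_eq_sum_down`). An
insertion step from size `n - 1` to size `n` multiplies it by `n`, because `∑ f^ν = (|μ| + 1) f^μ`
over the `ν` covering `μ` (`sum_up_numSYT`). The latter follows from the branching rule and the
commutation relation `DU - UD = 1` of Young's lattice (`sum_up_sum_down`).

The sum starts at `f^{(n)} = 1`, so it is `n ^ k` after `k` rounds and after the final removal.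
Shapes outside `Λ` contribute nothing: each removal shortens the first row by at most one box
(`numVac_eq_zero_of_rowLen_lt`). -/

namespace Vacillating

/-! ### Covers in Young's lattice -/

/-- `ν` is obtained from `κ` by adding one box. -/
def Covers (κ ν : YoungDiagram) : Prop := κ ≤ ν ∧ ν.card = κ.card + 1

theorem covers_iff_skewCard {κ ν : YoungDiagram} : Covers κ ν ↔ κ ≤ ν ∧ skewCard ν κ = 1 := by
  refine and_congr_right fun h => ?_
  have h1 := Finset.card_sdiff_add_card_eq_card (s := κ.cells) (t := ν.cells) h
  simp only [skewCard, YoungDiagram.card]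
  omega

theorem covers_of_cells_eq_insert {κ ν : YoungDiagram} {c : ℕ × ℕ} (hc : c ∉ κ)
    (h : ν.cells = insert c κ.cells) : Covers κ ν := by
  constructor
  · change κ.cells ⊆ ν.cells
    rw [h]
    exact Finset.subset_insert _ _
  · simp only [YoungDiagram.card]
    rw [h, Finset.card_insert_of_notMem (by simpa using hc)]

theorem Covers.exists_cells_eq_insert {κ ν : YoungDiagram} (h : Covers κ ν) :
    ∃ c, c ∉ κ ∧ ν.cells = insert c κ.cells := by
  have h1 : (ν.cells \ κ.cells).card = 1 := (covers_iff_skewCard.1 h).2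
  obtain ⟨c, hc⟩ := Finset.card_eq_one.1 h1
  have hc' : c ∈ ν.cells \ κ.cells := by simp [hc]
  refine ⟨c, by simpa using (Finset.mem_sdiff.1 hc').2, ?_⟩
  rw [← Finset.union_sdiff_of_subset (show κ.cells ⊆ ν.cells from h.1), hc, Finset.union_comm]
  rfl

/-- The Young diagrams obtained by adding one box to `μ`. -/
noncomputable def up (μ : YoungDiagram) : Finset YoungDiagram :=
  ((finite_card_le (μ.card + 1)).subset
    (t := {ν | Covers μ ν}) fun _ h => h.2.le).toFinset

/-- The Young diagrams obtained by removing one box from `μ`. -/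
noncomputable def down (μ : YoungDiagram) : Finset YoungDiagram :=
  ((finite_card_le μ.card).subset
    (t := {κ | Covers κ μ}) fun _ h => (Nat.le_succ _).trans h.2.ge).toFinset

/-- The Young diagrams with `N` boxes. -/
noncomputable def level (N : ℕ) : Finset YoungDiagram :=
  ((finite_card_le N).subset (t := {μ | μ.card = N}) fun _ h => le_of_eq h).toFinset

@[simp] theorem mem_up {μ ν : YoungDiagram} : ν ∈ up μ ↔ Covers μ ν := by simp [up]

@[simp] theorem mem_down {μ κ : YoungDiagram} : κ ∈ down μ ↔ Covers κ μ := by simp [down]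

@[simp] theorem mem_level {N : ℕ} {μ : YoungDiagram} : μ ∈ level N ↔ μ.card = N := by simp [level]

/-- If the join were smaller than `ν`, it would have no more boxes than `μ` or `μ'`, and hence equal
both. -/
theorem covers_sup_of_covers {μ μ' ν : YoungDiagram} (hne : μ' ≠ μ) (h : Covers μ ν)
    (h' : Covers μ' ν) : ν = μ ⊔ μ' := by
  have hle : (μ ⊔ μ').cells ⊆ ν.cells := show μ ⊔ μ' ≤ ν from sup_le h.1 h'.1
  symm
  apply YoungDiagram.ext
  apply Finset.eq_of_subset_of_card_le hle
  by_contra hlt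
  have h1 : μ.cells ⊆ (μ ⊔ μ').cells := show μ ≤ μ ⊔ μ' from le_sup_left
  have h2 : μ'.cells ⊆ (μ ⊔ μ').cells := show μ' ≤ μ ⊔ μ' from le_sup_right
  have e1 := h.2
  have e2 := h'.2
  simp only [YoungDiagram.card] at e1 e2
  have h3 := Finset.eq_of_subset_of_card_le h1 (by omega)
  have h4 := Finset.eq_of_subset_of_card_le h2 (by omega)
  exact hne (YoungDiagram.ext (h4.trans h3.symm))

theorem eq_inf_of_covers {μ μ' κ : YoungDiagram} (hne : μ' ≠ μ) (h : Covers κ μ)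
    (h' : Covers κ μ') : κ = μ ⊓ μ' := by
  have hle : κ.cells ⊆ (μ ⊓ μ').cells := show κ ≤ μ ⊓ μ' from le_inf h.1 h'.1
  apply YoungDiagram.ext
  apply Finset.eq_of_subset_of_card_le hle
  by_contra hlt
  have h1 : (μ ⊓ μ').cells ⊆ μ.cells := show μ ⊓ μ' ≤ μ from inf_le_left
  have h2 : (μ ⊓ μ').cells ⊆ μ'.cells := show μ ⊓ μ' ≤ μ' from inf_le_right
  have e1 := h.2
  have e2 := h'.2
  simp only [YoungDiagram.card] at e1 e2
  have h3 := Finset.eq_of_subset_of_card_le h1 (by omega)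
  have h4 := Finset.eq_of_subset_of_card_le h2 (by omega)
  exact hne (YoungDiagram.ext (h4.symm.trans h3))

theorem card_sup_add_card_inf (μ ν : YoungDiagram) :
    (μ ⊔ ν).card + (μ ⊓ ν).card = μ.card + ν.card := by
  simp only [YoungDiagram.card, YoungDiagram.cells_sup, YoungDiagram.cells_inf]
  exact Finset.card_union_add_card_inter _ _

/-! ### Addable and removable boxes, and the commutation relation -/

/-- The diagram `μ` with one box added at the end of row `i`. -/
def addBox (μ : YoungDiagram) (i : ℕ) (h : ∀ j, i = j + 1 → μ.rowLen i < μ.rowLen j) :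
    YoungDiagram where
  cells := insert (i, μ.rowLen i) μ.cells
  isLowerSet := by
    rintro ⟨a, b⟩ ⟨a', b'⟩ hle hmem
    obtain ⟨h1, h2⟩ : a' ≤ a ∧ b' ≤ b := hle
    simp only [Finset.coe_insert, Set.mem_insert_iff, Prod.mk.injEq, Finset.mem_coe,
      YoungDiagram.mem_cells] at hmem ⊢
    rcases hmem with ⟨rfl, rfl⟩ | hmem
    · rcases h1.lt_or_eq with h3 | rfl
      · right
        obtain ⟨j, rfl⟩ := Nat.exists_eq_succ_of_ne_zero (by omega : a ≠ 0)
        have := h j rfl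
        have h4 := μ.rowLen_anti a' j (by omega)
        rw [YoungDiagram.mem_iff_lt_rowLen]
        simp only [Nat.succ_eq_add_one] at *
        omega
      · rcases h2.lt_or_eq with h3 | rfl
        · exact Or.inr (YoungDiagram.mem_iff_lt_rowLen.2 h3)
        · exact Or.inl ⟨rfl, rfl⟩
    · exact Or.inr (μ.up_left_mem h1 h2 hmem)

/-- The diagram `μ` with the last box of row `i` removed. -/
def removeBox (μ : YoungDiagram) (i : ℕ) (h : μ.rowLen (i + 1) < μ.rowLen i) :
    YoungDiagram where
  cells := μ.cells.erase (i, μ.rowLen i - 1)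
  isLowerSet := by
    rintro ⟨a, b⟩ ⟨a', b'⟩ hle hmem
    obtain ⟨h1, h2⟩ : a' ≤ a ∧ b' ≤ b := hle
    simp only [Finset.coe_erase, Set.mem_sdiff, Finset.mem_coe, YoungDiagram.mem_cells,
      Set.mem_singleton_iff, Prod.mk.injEq] at hmem ⊢
    refine ⟨μ.up_left_mem h1 h2 hmem.1, ?_⟩
    rintro ⟨rfl, rfl⟩
    have h3 := YoungDiagram.mem_iff_lt_rowLen.1 hmem.1
    rcases h1.lt_or_eq with h4 | rfl
    · have := μ.rowLen_anti (a' + 1) a h4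
      omega
    · exact hmem.2 ⟨rfl, by omega⟩

/-- The rows of `μ` whose last box can be removed. -/
def removableRows (μ : YoungDiagram) : Finset ℕ :=
  {i ∈ Finset.range (μ.colLen 0) | μ.rowLen (i + 1) < μ.rowLen i}

theorem mem_removableRows {μ : YoungDiagram} {i : ℕ} :
    i ∈ removableRows μ ↔ μ.rowLen (i + 1) < μ.rowLen i := by
  simp only [removableRows, Finset.mem_filter, Finset.mem_range, and_iff_right_iff_imp]
  intro h
  rw [← YoungDiagram.mem_iff_lt_colLen, YoungDiagram.mem_iff_lt_rowLen]
  omega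

theorem card_down (μ : YoungDiagram) : (down μ).card = (removableRows μ).card := by
  symm
  refine Finset.card_bij (fun i hi => removeBox μ i (mem_removableRows.1 hi)) ?_ ?_ ?_
  · intro i hi
    have hi' := mem_removableRows.1 hi
    rw [mem_down]
    refine covers_of_cells_eq_insert (c := (i, μ.rowLen i - 1)) ?_ ?_
    · rw [← YoungDiagram.mem_cells]
      simp [removeBox]
    · simp only [removeBox]
      rw [Finset.insert_erase]
      rw [YoungDiagram.mem_cells, YoungDiagram.mem_iff_lt_rowLen]
      omega
  · intro i hi j hj h
    have hi' := mem_removableRows.1 hi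
    have h1 := congrArg YoungDiagram.cells h
    simp only [removeBox] at h1
    have h2 : (i, μ.rowLen i - 1) ∈ μ.cells := by
      rw [YoungDiagram.mem_cells, YoungDiagram.mem_iff_lt_rowLen]
      omega
    exact congrArg Prod.fst ((Finset.erase_injOn μ.cells).eq_iff h2 (by
      have hj' := mem_removableRows.1 hj
      simp only [Finset.mem_coe]
      rw [YoungDiagram.mem_cells, YoungDiagram.mem_iff_lt_rowLen]
      omega) |>.1 h1)
  · intro κ hκ
    obtain ⟨⟨i, j⟩, hc, hcells⟩ := (mem_down.1 hκ).exists_cells_eq_insert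
    have hmem : ∀ c, c ∈ μ ↔ c = (i, j) ∨ c ∈ κ := by
      intro c
      rw [← YoungDiagram.mem_cells, hcells, Finset.mem_insert, YoungDiagram.mem_cells]
    have h1 : j < μ.rowLen i := YoungDiagram.mem_iff_lt_rowLen.1 ((hmem _).2 (Or.inl rfl))
    have h2 : ∀ a b, i ≤ a → j ≤ b → (a, b) ∈ μ → (a, b) = (i, j) := by
      intro a b ha hb hab
      rcases (hmem _).1 hab with h | h
      · exact h
      · exact absurd (κ.up_left_mem ha hb h) hc
    have h3 : μ.rowLen i = j + 1 := by
      by_contra hne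
      have := h2 i (j + 1) le_rfl (by omega) (YoungDiagram.mem_iff_lt_rowLen.2 (by omega))
      simp at this
    have h4 : μ.rowLen (i + 1) < μ.rowLen i := by
      by_contra hlt
      have := h2 (i + 1) j (by omega) le_rfl (YoungDiagram.mem_iff_lt_rowLen.2 (by omega))
      simp at this
    refine ⟨i, mem_removableRows.2 h4, YoungDiagram.ext ?_⟩
    simp only [removeBox]
    rw [hcells, h3, Nat.add_sub_cancel, Finset.erase_insert (by simpa using hc)]

/-- The right side says that row `i` can take a box: row `0` always can, and row `j + 1` can exactly
when row `j` can lose one. This shift gives one more addable box than removable ones. -/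
theorem mem_insert_zero_image_succ {μ : YoungDiagram} {i : ℕ} :
    i ∈ insert 0 ((removableRows μ).image Nat.succ) ↔
      ∀ j, i = j + 1 → μ.rowLen i < μ.rowLen j := by
  cases i with
  | zero => simp
  | succ i =>
    simp only [Finset.mem_insert, Finset.mem_image, mem_removableRows]
    constructor
    · rintro (h | ⟨a, h, h'⟩) j hj
      · omega
      · obtain rfl : a = i := by omega
        obtain rfl : a = j := by omega
        exact h
    · intro h
      exact Or.inr ⟨i, h i rfl, rfl⟩

theorem card_up (μ : YoungDiagram) : (up μ).card = (down μ).card + 1 := by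
  have hA : (insert 0 ((removableRows μ).image Nat.succ)).card = (down μ).card + 1 := by
    rw [Finset.card_insert_of_notMem (by simp),
      Finset.card_image_of_injective _ Nat.succ_injective, card_down]
  rw [← hA]
  symm
  refine Finset.card_bij (fun i hi => addBox μ i (mem_insert_zero_image_succ.1 hi)) ?_ ?_ ?_
  · intro i hi
    rw [mem_up]
    refine covers_of_cells_eq_insert (c := (i, μ.rowLen i)) ?_ rfl
    rw [YoungDiagram.mem_iff_lt_rowLen]
    omega
  · intro i hi j hj h
    have h1 := congrArg YoungDiagram.cells h
    simp only [addBox] at h1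
    have h2 : (i, μ.rowLen i) ∈ insert (j, μ.rowLen j) μ.cells := by
      rw [← h1]
      exact Finset.mem_insert_self _ _
    rcases Finset.mem_insert.1 h2 with h3 | h3
    · exact congrArg Prod.fst h3
    · rw [YoungDiagram.mem_cells, YoungDiagram.mem_iff_lt_rowLen] at h3
      omega
  · intro ν hν
    obtain ⟨⟨i, j⟩, hc, hcells⟩ := (mem_up.1 hν).exists_cells_eq_insert
    have hmem : ∀ c, c ∈ ν ↔ c = (i, j) ∨ c ∈ μ := by
      intro c
      rw [← YoungDiagram.mem_cells, hcells, Finset.mem_insert, YoungDiagram.mem_cells]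
    have h1 : ∀ a b, a ≤ i → b ≤ j → (a, b) ≠ (i, j) → (a, b) ∈ μ := by
      intro a b ha hb hab
      exact ((hmem _).1 (ν.up_left_mem ha hb ((hmem _).2 (Or.inl rfl)))).resolve_left hab
    have h2 : μ.rowLen i = j := by
      rw [YoungDiagram.mem_iff_lt_rowLen] at hc
      by_contra hne
      have := YoungDiagram.mem_iff_lt_rowLen.1
        (h1 i (μ.rowLen i) le_rfl (by omega) (by simpa using hne))
      omega
    refine ⟨i, mem_insert_zero_image_succ.2 ?_, YoungDiagram.ext ?_⟩
    · rintro a rfl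
      rw [h2]
      exact YoungDiagram.mem_iff_lt_rowLen.1 (h1 a j (by omega) le_rfl (by simp))
    · simp only [addBox]
      rw [hcells, h2]

/-- The commutation relation `DU - UD = 1` of Young's lattice. -/
theorem sum_up_sum_down (g : YoungDiagram → ℕ) (μ : YoungDiagram) :
    ∑ ν ∈ up μ, ∑ μ' ∈ down ν, g μ' = ∑ κ ∈ down μ, ∑ μ' ∈ up κ, g μ' + g μ := by
  classical
  have h1 : ∀ ν ∈ up μ, ∑ μ' ∈ down ν, g μ' = ∑ μ' ∈ (down ν).erase μ, g μ' + g μ :=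
    -- The terms `μ' = μ` are split off: there are `(up μ).card` of them on the left and `(down
    -- μ).card` on the right, one fewer.
    fun ν hν => (Finset.sum_erase_add _ _ (mem_down.2 (mem_up.1 hν))).symm
  have h2 : ∀ κ ∈ down μ, ∑ μ' ∈ up κ, g μ' = ∑ μ' ∈ (up κ).erase μ, g μ' + g μ :=
    fun κ hκ => (Finset.sum_erase_add _ _ (mem_up.2 (mem_down.1 hκ))).symm
  rw [Finset.sum_congr rfl h1, Finset.sum_congr rfl h2, Finset.sum_add_distrib,
    Finset.sum_add_distrib, Finset.sum_const, Finset.sum_const, card_up, add_smul, one_smul,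
    ← add_assoc]
  congr 2
  rw [Finset.sum_sigma', Finset.sum_sigma']
  -- For `μ' ≠ μ` the intermediate shape is forced to be the join or the meet, and
  -- `card_sup_add_card_inf` shows that one is a cover exactly when the other is.
  refine Finset.sum_nbij' (fun p => ⟨μ ⊓ p.2, p.2⟩) (fun p => ⟨μ ⊔ p.2, p.2⟩) ?_ ?_ ?_ ?_ ?_
  · rintro ⟨ν, μ'⟩ h
    simp only [Finset.mem_sigma, mem_up, Finset.mem_erase, mem_down] at h ⊢
    obtain ⟨h1, hne, h2⟩ := h
    have h3 := covers_sup_of_covers hne h1 h2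
    have h4 := card_sup_add_card_inf μ μ'
    have h5 := h1.2
    have h6 := h2.2
    rw [h3] at h5 h6
    exact ⟨⟨inf_le_left, by omega⟩, hne, inf_le_right, by omega⟩
  · rintro ⟨κ, μ'⟩ h
    simp only [Finset.mem_sigma, mem_up, Finset.mem_erase, mem_down] at h ⊢
    obtain ⟨h1, hne, h2⟩ := h
    have h3 := eq_inf_of_covers hne h1 h2
    have h4 := card_sup_add_card_inf μ μ'
    have h5 := h1.2
    have h6 := h2.2
    rw [h3] at h5 h6
    exact ⟨⟨le_sup_left, by omega⟩, hne, le_sup_right, by omega⟩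
  · rintro ⟨ν, μ'⟩ h
    simp only [Finset.mem_sigma, mem_up, Finset.mem_erase, mem_down] at h ⊢
    rw [covers_sup_of_covers h.2.1 h.1 h.2.2]
  · rintro ⟨κ, μ'⟩ h
    simp only [Finset.mem_sigma, mem_up, Finset.mem_erase, mem_down] at h ⊢
    rw [eq_inf_of_covers h.2.1 h.1 h.2.2]
  · intros
    rfl

/-! ### Standard tableaux and the branching rule -/

theorem icc_one_succ_val (m : ℕ) :
    (Finset.Icc 1 (m + 1)).val = (m + 1) ::ₘ (Finset.Icc 1 m).val := by
  rw [← Finset.insert_Icc_right_eq_Icc_add_one (by omega), Finset.insert_val_of_notMem (by simp)]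

theorem map_val_eq_cons {κ ν : YoungDiagram} {c : ℕ × ℕ} (hc : c ∉ κ)
    (h : ν.cells = insert c κ.cells) (F : ℕ × ℕ → ℕ) :
    ν.cells.val.map F = F c ::ₘ κ.cells.val.map F := by
  rw [h, Finset.insert_val_of_notMem (by simpa using hc), Multiset.map_cons]

theorem IsStandard.injOn {μ : YoungDiagram} {T : SemistandardYoungTableau μ} (h : IsStandard T)
    {c d : ℕ × ℕ} (hc : c ∈ μ) (hd : d ∈ μ) (hcd : T c.1 c.2 = T d.1 d.2) : c = d := by
  have h1 : (μ.cells.val.map (fun c => T c.1 c.2)).Nodup := by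
    rw [show μ.cells.val.map (fun c => T c.1 c.2) = _ from h]
    exact Finset.nodup _
  exact Multiset.inj_on_of_nodup_map h1 c hc d hd hcd

theorem IsStandard.mem_Icc {μ : YoungDiagram} {T : SemistandardYoungTableau μ} (h : IsStandard T)
    {c : ℕ × ℕ} (hc : c ∈ μ) : 1 ≤ T c.1 c.2 ∧ T c.1 c.2 ≤ μ.card := by
  have h1 : T c.1 c.2 ∈ μ.cells.val.map (fun c => T c.1 c.2) :=
    Multiset.mem_map.2 ⟨c, hc, rfl⟩
  rw [show μ.cells.val.map (fun c => T c.1 c.2) = _ from h] at h1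
  exact Finset.mem_Icc.1 h1

theorem entry_mono {μ : YoungDiagram} (T : SemistandardYoungTableau μ) {c d : ℕ × ℕ} (hcd : c ≤ d)
    (hd : d ∈ μ) : T c.1 c.2 ≤ T d.1 d.2 :=
  (T.col_weak hcd.1 (μ.up_left_mem le_rfl hcd.2 hd)).trans (T.row_weak_of_le hcd.2 hd)

theorem Covers.eq_of_le_of_notMem {κ ν : YoungDiagram} (h : Covers κ ν) {c d : ℕ × ℕ} (hc : c ∈ ν)
    (hcκ : c ∉ κ) (hd : d ∈ ν) (hcd : c ≤ d) : c = d := by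
  obtain ⟨e, he, hcells⟩ := h.exists_cells_eq_insert
  rw [← YoungDiagram.mem_cells, hcells, Finset.mem_insert] at hc hd
  rcases hd with rfl | hd
  · exact hc.resolve_right hcκ
  · exact absurd (κ.up_left_mem hcd.1 hcd.2 hd) hcκ

open Classical in
/-- Extend a tableau by putting the largest entry into the added box. -/
noncomputable def extendTableau {κ ν : YoungDiagram} (h : Covers κ ν) (S : SYT κ) :
    SemistandardYoungTableau ν where
  entry i j := if (i, j) ∈ κ then S.1 i j else if (i, j) ∈ ν then ν.card else 0
  row_weak' := by
    intro i j₁ j₂ hj hmem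
    by_cases h2 : (i, j₂) ∈ κ
    · have h1 := κ.up_left_mem le_rfl hj.le h2
      simp only [h1, h2, if_true]
      exact S.1.row_weak hj h2
    · simp only [h2, hmem, if_true, if_false]
      split_ifs with h1 h3
      · have := (S.2.mem_Icc h1).2
        have := h.2
        dsimp only at *
        omega
      · exact le_rfl
      · exact Nat.zero_le _
  col_strict' := by
    intro i₁ i₂ j hi hmem
    by_cases h2 : (i₂, j) ∈ κ
    · have h1 := κ.up_left_mem hi.le le_rfl h2
      simp only [h1, h2, if_true]
      exact S.1.col_strict hi h2
    · have h1 : (i₁, j) ∈ κ := by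
        by_contra h1
        have := h.eq_of_le_of_notMem (ν.up_left_mem hi.le le_rfl hmem) h1 hmem ⟨hi.le, le_rfl⟩
        simp only [Prod.mk.injEq] at this
        omega
      simp only [h2, h1, hmem, if_true, if_false]
      have := (S.2.mem_Icc h1).2
      have := h.2
      dsimp only at *
      omega
  zeros' := by
    intro i j hmem
    have h1 : (i, j) ∉ κ := fun h1 => hmem (h.1 h1)
    simp [h1, hmem]

theorem extendTableau_of_mem {κ ν : YoungDiagram} (h : Covers κ ν) (S : SYT κ) {i j : ℕ}
    (hij : (i, j) ∈ κ) : extendTableau h S i j = S.1 i j := if_pos hij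

theorem extendTableau_of_notMem {κ ν : YoungDiagram} (h : Covers κ ν) (S : SYT κ) {i j : ℕ}
    (hij : (i, j) ∉ κ) (hij' : (i, j) ∈ ν) : extendTableau h S i j = ν.card :=
  (if_neg hij).trans (if_pos hij')

theorem isStandard_extendTableau {κ ν : YoungDiagram} (h : Covers κ ν) (S : SYT κ) :
    IsStandard (extendTableau h S) := by
  obtain ⟨c, hc, hcells⟩ := h.exists_cells_eq_insert
  have hcν : c ∈ ν := by
    rw [← YoungDiagram.mem_cells, hcells]
    exact Finset.mem_insert_self _ _
  unfold IsStandard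
  rw [map_val_eq_cons hc hcells, extendTableau_of_notMem h S hc hcν, h.2, icc_one_succ_val]
  congr 1
  rw [← show κ.cells.val.map (fun c => S.1 c.1 c.2) = _ from S.2]
  exact Multiset.map_congr rfl fun d hd => extendTableau_of_mem h S hd

/-- Adding the box with the largest entry, as a map to standard tableaux. -/
noncomputable def extendSYT (ν : YoungDiagram) (p : Σ κ : down ν, SYT κ.1) : SYT ν :=
  ⟨extendTableau (mem_down.1 p.1.2) p.2, isStandard_extendTableau _ _⟩

/-- The extended tableau determines the smaller shape, since only the new box carries the largest
entry; injectivity of `extendSYT` rests on this. -/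
theorem mem_iff_extendTableau_lt {κ ν : YoungDiagram} (h : Covers κ ν) (S : SYT κ) {c : ℕ × ℕ} :
    c ∈ κ ↔ c ∈ ν ∧ extendTableau h S c.1 c.2 < ν.card := by
  constructor
  · intro hc
    refine ⟨h.1 hc, ?_⟩
    rw [extendTableau_of_mem h S hc]
    have := (S.2.mem_Icc hc).2
    have := h.2
    omega
  · rintro ⟨h1, h2⟩
    by_contra hc
    rw [extendTableau_of_notMem h S hc h1] at h2
    omega

theorem extendSYT_injective (ν : YoungDiagram) : Function.Injective (extendSYT ν) := by
  rintro ⟨⟨κ, hκ⟩, S⟩ ⟨⟨κ', hκ'⟩, S'⟩ h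
  have h1 : extendTableau (mem_down.1 hκ) S = extendTableau (mem_down.1 hκ') S' :=
    congrArg Subtype.val h
  obtain rfl : κ = κ' := by
    apply YoungDiagram.ext
    ext c
    rw [YoungDiagram.mem_cells, YoungDiagram.mem_cells,
      mem_iff_extendTableau_lt (mem_down.1 hκ) S, mem_iff_extendTableau_lt (mem_down.1 hκ') S', h1]
  congr 1
  apply Subtype.ext
  ext i j
  by_cases hij : (i, j) ∈ κ
  · rw [← extendTableau_of_mem (mem_down.1 hκ) S hij, h1, extendTableau_of_mem _ _ hij]
  · rw [S.1.zeros hij, S'.1.zeros hij]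

open Classical in
/-- The restriction of a tableau to a smaller shape. -/
noncomputable def restrictTableau {κ ν : YoungDiagram} (h : κ ≤ ν)
    (T : SemistandardYoungTableau ν) : SemistandardYoungTableau κ where
  entry i j := if (i, j) ∈ κ then T i j else 0
  row_weak' := by
    intro i j₁ j₂ hj hmem
    have h1 := κ.up_left_mem le_rfl hj.le hmem
    simp only [h1, hmem, if_true]
    exact T.row_weak hj (h hmem)
  col_strict' := by
    intro i₁ i₂ j hi hmem
    have h1 := κ.up_left_mem hi.le le_rfl hmem
    simp only [h1, hmem, if_true]
    exact T.col_strict hi (h hmem)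
  zeros' := by
    intro i j hmem
    simp [hmem]

theorem restrictTableau_of_mem {κ ν : YoungDiagram} (h : κ ≤ ν) (T : SemistandardYoungTableau ν)
    {i j : ℕ} (hij : (i, j) ∈ κ) : restrictTableau h T i j = T i j := if_pos hij

/-- The preimage is found by deleting the box `c` with entry `|ν|`. Entries are weakly increasing
and distinct, so no box lies beyond `c` and a diagram remains. The empty shape must be excluded: it
has one tableau but covers nothing. -/
theorem extendSYT_surjective (ν : YoungDiagram) (hν : ν.card ≠ 0) :
    Function.Surjective (extendSYT ν) := by
  intro T
  have h1 : ν.card ∈ ν.cells.val.map (fun c => T.1 c.1 c.2) := by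
    rw [show ν.cells.val.map (fun c => T.1 c.1 c.2) = _ from T.2]
    exact Finset.mem_Icc.2 ⟨Nat.one_le_iff_ne_zero.2 hν, le_rfl⟩
  obtain ⟨c, hc, hTc⟩ := Multiset.mem_map.1 h1
  have hcν : c ∈ ν := hc
  let κ : YoungDiagram :=
    { cells := ν.cells.erase c
      isLowerSet := by
        intro d e hed hd
        simp only [Finset.coe_erase, Set.mem_sdiff, Finset.mem_coe, YoungDiagram.mem_cells,
          Set.mem_singleton_iff] at hd ⊢
        refine ⟨ν.up_left_mem hed.1 hed.2 hd.1, ?_⟩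
        rintro rfl
        have h2 := entry_mono T.1 hed hd.1
        have h3 := (T.2.mem_Icc hd.1).2
        exact hd.2 (T.2.injOn hd.1 hcν (le_antisymm (h3.trans hTc.ge) h2)) }
  have hcκ : c ∉ κ := by
    rw [← YoungDiagram.mem_cells]
    simp [κ]
  have hcells : ν.cells = insert c κ.cells := (Finset.insert_erase hc).symm
  have hcov : Covers κ ν := covers_of_cells_eq_insert hcκ hcells
  have hstd : IsStandard (restrictTableau hcov.1 T.1) := by
    have h2 : ν.cells.val.map (fun c => T.1 c.1 c.2) = _ := T.2
    rw [map_val_eq_cons hcκ hcells, hTc, hcov.2, icc_one_succ_val] at h2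
    unfold IsStandard
    rw [← (Multiset.cons_inj_right _).1 h2]
    exact Multiset.map_congr rfl fun d hd => restrictTableau_of_mem hcov.1 T.1 hd
  refine ⟨⟨⟨κ, mem_down.2 hcov⟩, ⟨_, hstd⟩⟩, Subtype.ext ?_⟩
  change extendTableau hcov _ = T.1
  ext i j
  by_cases hij : (i, j) ∈ κ
  · rw [extendTableau_of_mem hcov _ hij]
    exact restrictTableau_of_mem hcov.1 T.1 hij
  · by_cases hij' : (i, j) ∈ ν
    · rw [extendTableau_of_notMem hcov _ hij hij', ← hTc]
      rw [← YoungDiagram.mem_cells, hcells, Finset.mem_insert] at hij'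
      rw [← hij'.resolve_right hij]
    · rw [SemistandardYoungTableau.zeros _ hij', T.1.zeros hij']

/-- The branching rule `f^ν = ∑ f^κ` over the shapes `κ` obtained by removing a box from `ν`. -/
theorem numSYT_eq_sum_down (ν : YoungDiagram) (hν : ν.card ≠ 0) :
    numSYT ν = ∑ κ ∈ down ν, numSYT κ := by
  unfold numSYT
  rw [← Nat.card_eq_of_bijective _ ⟨extendSYT_injective ν, extendSYT_surjective ν hν⟩,
    Nat.card_sigma, Finset.sum_coe_sort (down ν) (fun κ => Nat.card (SYT κ))]

/-- Branching each `f^ν` and commuting up past down leaves `f^μ` plus the same sums over shapes one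
box smaller; by induction and branching again, those give `|μ| f^μ`. -/
theorem sum_up_numSYT (μ : YoungDiagram) :
    ∑ ν ∈ up μ, numSYT ν = (μ.card + 1) * numSYT μ := by
  induction h : μ.card generalizing μ with
  | zero =>
    have hd : down μ = ∅ := by
      ext κ
      simp only [mem_down, Finset.notMem_empty, iff_false]
      intro hκ
      have := hκ.2
      omega
    rw [Finset.sum_congr rfl fun ν hν => numSYT_eq_sum_down ν (by rw [(mem_up.1 hν).2]; omega),
      sum_up_sum_down, hd]
    simp
  | succ m ih =>
    rw [Finset.sum_congr rfl fun ν hν => numSYT_eq_sum_down ν (by rw [(mem_up.1 hν).2]; omega),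
      sum_up_sum_down, Finset.sum_congr rfl fun κ hκ => ih κ (by
        have := (mem_down.1 hκ).2
        omega), ← Finset.mul_sum, ← numSYT_eq_sum_down μ (by omega)]
    ring

/-! ### One-row shapes -/

theorem mem_oneRow {n i j : ℕ} : (i, j) ∈ oneRow n ↔ i = 0 ∧ j < n := by
  rw [oneRow, YoungDiagram.mem_ofRowLens]
  simp only [List.length_singleton, Nat.lt_one_iff]
  constructor
  · rintro ⟨h, h'⟩
    subst h
    exact ⟨rfl, by simpa using h'⟩
  · rintro ⟨rfl, h⟩
    exact ⟨rfl, by simpa using h⟩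

theorem rowLen_oneRow (n : ℕ) : (oneRow n).rowLen 0 = n := by
  refine le_antisymm ?_ ?_
  · by_contra h
    have := (mem_oneRow.1 (YoungDiagram.mem_iff_lt_rowLen.2 (not_le.1 h))).2
    omega
  · by_contra h
    have := YoungDiagram.mem_iff_lt_rowLen.1 (mem_oneRow.2 ⟨rfl, not_le.1 h⟩)
    omega

theorem card_oneRow (n : ℕ) : (oneRow n).card = n := by
  conv_rhs => rw [← rowLen_oneRow n, YoungDiagram.rowLen_eq_card]
  unfold YoungDiagram.row YoungDiagram.card
  rw [Finset.filter_true_of_mem]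
  rintro ⟨i, j⟩ h
  exact (mem_oneRow.1 h).1

theorem eq_oneRow_of_le {κ : YoungDiagram} {n : ℕ} (h : κ ≤ oneRow n) : κ = oneRow κ.card := by
  have h1 : κ = oneRow (κ.rowLen 0) := by
    apply YoungDiagram.ext
    ext ⟨i, j⟩
    rw [YoungDiagram.mem_cells, YoungDiagram.mem_cells, mem_oneRow]
    constructor
    · intro hij
      obtain ⟨rfl, -⟩ := mem_oneRow.1 (h hij)
      exact ⟨rfl, YoungDiagram.mem_iff_lt_rowLen.1 hij⟩
    · rintro ⟨rfl, hj⟩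
      exact YoungDiagram.mem_iff_lt_rowLen.2 hj
  have h2 : κ.card = κ.rowLen 0 := by
    rw [h1, card_oneRow, rowLen_oneRow]
  rw [h2]
  exact h1

theorem down_oneRow_succ (n : ℕ) : down (oneRow (n + 1)) = {oneRow n} := by
  ext κ
  rw [mem_down, Finset.mem_singleton]
  constructor
  · rintro ⟨h1, h2⟩
    rw [card_oneRow] at h2
    rw [eq_oneRow_of_le h1, show κ.card = n by omega]
  · rintro rfl
    refine ⟨?_, by simp only [card_oneRow]⟩
    rintro ⟨i, j⟩ h
    have := mem_oneRow.1 h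
    exact mem_oneRow.2 ⟨this.1, by omega⟩

theorem numSYT_oneRow (n : ℕ) : numSYT (oneRow n) = 1 := by
  induction n with
  | zero =>
    have he : ∀ i j, (i, j) ∉ oneRow 0 := fun i j h => by
      have := (mem_oneRow.1 h).2
      omega
    have hcells : (oneRow 0).cells = ∅ := Finset.card_eq_zero.1 (card_oneRow 0)
    refine Nat.card_eq_one_iff_unique.2 ⟨⟨fun S T => Subtype.ext ?_⟩, ⟨⟨⟨fun _ _ => 0, ?_, ?_, ?_⟩, ?_⟩⟩⟩
    · ext i j
      rw [S.1.zeros (he i j), T.1.zeros (he i j)]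
    · intros
      exact le_rfl
    · intro _ i₂ j _ h
      exact absurd h (he i₂ j)
    · intros
      rfl
    · unfold IsStandard
      rw [hcells, card_oneRow]
      rfl
  | succ n ih =>
    rw [numSYT_eq_sum_down _ (by rw [card_oneRow]; omega), down_oneRow_succ,
      Finset.sum_singleton, ih]

/-! ### Recursion and vanishing for vacillating tableaux -/

/-- A vacillating tableau of length `L + 1` is one of length `L` with one more step. -/
theorem numVac_succ_eq_sum {n L : ℕ} {μ : YoungDiagram} (s : Finset YoungDiagram)
    (hs : ∀ ν, ν ∈ s ↔ (Even L → Covers μ ν) ∧ (Odd L → Covers ν μ)) :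
    numVac n (L + 1) μ = ∑ ν ∈ s, numVac n L ν := by
  unfold numVac
  rw [← Finset.sum_coe_sort s (fun ν => Nat.card (VacTableau n L ν)), ← Nat.card_sigma]
  refine Nat.card_congr
    { toFun := fun P => ⟨⟨P.shape (Fin.last L).castSucc, (hs _).2 ⟨fun h => ?_, fun h => ?_⟩⟩,
        { shape := fun i => P.shape i.castSucc
          first := P.first
          final := rfl
          remove := fun i hi => P.remove i.castSucc hi
          insert := fun i hi => P.insert i.castSucc hi }⟩
      invFun := fun p =>
        { shape := Fin.snoc (α := fun _ => YoungDiagram) p.2.shape μ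
          first := ?_
          final := ?_
          remove := ?_
          insert := ?_ }
      left_inv := ?_
      right_inv := ?_ }
  · have := P.remove (Fin.last L) h
    rw [Fin.succ_last, P.final] at this
    exact covers_iff_skewCard.2 this
  · have := P.insert (Fin.last L) h
    rw [Fin.succ_last, P.final] at this
    exact covers_iff_skewCard.2 this
  · rw [← Fin.castSucc_zero, Fin.snoc_castSucc]
    exact p.2.first
  · exact Fin.snoc_last _ _
  · intro i
    induction i using Fin.lastCases with
    | last =>
      intro hi
      rw [Fin.succ_last, Fin.snoc_last, Fin.snoc_castSucc, p.2.final]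
      exact covers_iff_skewCard.1 (((hs _).1 p.1.2).1 hi)
    | cast i =>
      intro hi
      rw [Fin.succ_castSucc, Fin.snoc_castSucc, Fin.snoc_castSucc]
      exact p.2.remove i hi
  · intro i
    induction i using Fin.lastCases with
    | last =>
      intro hi
      rw [Fin.succ_last, Fin.snoc_last, Fin.snoc_castSucc, p.2.final]
      exact covers_iff_skewCard.1 (((hs _).1 p.1.2).2 hi)
    | cast i =>
      intro hi
      rw [Fin.succ_castSucc, Fin.snoc_castSucc, Fin.snoc_castSucc]
      exact p.2.insert i hi
  · intro P
    ext1
    funext i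
    induction i using Fin.lastCases with
    | last =>
      dsimp only
      rw [Fin.snoc_last, P.final]
    | cast i =>
      dsimp only
      rw [Fin.snoc_castSucc]
  · rintro ⟨⟨ν, hν⟩, P⟩
    have h1 : ∀ i, (Fin.snoc (α := fun _ => YoungDiagram) P.shape μ : Fin (L + 2) → YoungDiagram)
        i.castSucc = P.shape i := fun i => Fin.snoc_castSucc _ _ _
    rw [Sigma.mk.injEq]
    refine ⟨Subtype.ext ((h1 _).trans P.final), ?_⟩
    -- The final shape is an index of the type and agrees only propositionally, so it is generalized
    -- before the walks are compared.
    have key : ∀ (a b : s) (Q : VacTableau n L a) (R : VacTableau n L b), a = b →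
        Q.shape = R.shape → Q ≍ R := by
      rintro a _ Q R rfl h
      exact heq_of_eq (VacTableau.ext h)
    exact key _ _ _ _ (Subtype.ext ((h1 _).trans P.final)) (funext h1)

theorem numVac_succ_of_even {n L : ℕ} (hL : Even L) (μ : YoungDiagram) :
    numVac n (L + 1) μ = ∑ ν ∈ up μ, numVac n L ν :=
  numVac_succ_eq_sum _ fun ν => by simp [hL, Nat.not_odd_iff_even.2 hL]

theorem numVac_succ_of_odd {n L : ℕ} (hL : Odd L) (μ : YoungDiagram) :
    numVac n (L + 1) μ = ∑ κ ∈ down μ, numVac n L κ :=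
  numVac_succ_eq_sum _ fun ν => by simp [hL, Nat.not_even_iff_odd.2 hL]

theorem numVac_zero_oneRow (n : ℕ) : numVac n 0 (oneRow n) = 1 := by
  refine Nat.card_eq_one_iff_unique.2 ⟨⟨fun P Q => ?_⟩,
    ⟨⟨fun _ => oneRow n, rfl, rfl, fun i => i.elim0, fun i => i.elim0⟩⟩⟩
  ext1
  funext i
  rw [Fin.fin_one_eq_zero i]
  exact P.first.trans Q.first.symm

theorem numVac_zero_of_ne {n : ℕ} {μ : YoungDiagram} (h : μ ≠ oneRow n) : numVac n 0 μ = 0 := by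
  have : IsEmpty (VacTableau n 0 μ) := ⟨fun P => h (P.final.symm.trans P.first)⟩
  exact Nat.card_of_isEmpty

theorem Covers.rowLen_le {κ ν : YoungDiagram} (h : Covers κ ν) (i : ℕ) :
    κ.rowLen i ≤ ν.rowLen i ∧ ν.rowLen i ≤ κ.rowLen i + 1 := by
  obtain ⟨c, hc, hcells⟩ := h.exists_cells_eq_insert
  simp only [YoungDiagram.rowLen_eq_card, YoungDiagram.row]
  rw [hcells]
  constructor
  · exact Finset.card_le_card (Finset.filter_subset_filter _ (Finset.subset_insert _ _))
  · rw [Finset.filter_insert]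
    split_ifs
    · exact Finset.card_insert_le _ _
    · omega

/-- Among `L` steps there are `(L + 1) / 2` removals, each costing the first row at most one box,
and insertions never shorten it. -/
theorem numVac_eq_zero_of_rowLen_lt {n L : ℕ} {μ : YoungDiagram}
    (h : μ.rowLen 0 + (L + 1) / 2 < n) : numVac n L μ = 0 := by
  induction L generalizing μ with
  | zero =>
    apply numVac_zero_of_ne
    rintro rfl
    rw [rowLen_oneRow] at h
    omega
  | succ L ih =>
    rcases Nat.even_or_odd L with hL | hL
    · rw [numVac_succ_of_even hL]
      refine Finset.sum_eq_zero fun ν hν => ih ?_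
      have := ((mem_up.1 hν).rowLen_le 0).2
      -- Evenness of `L` is what makes the removal count rise by one here.
      obtain ⟨m, rfl⟩ := hL
      omega
    · rw [numVac_succ_of_odd hL]
      refine Finset.sum_eq_zero fun κ hκ => ih ?_
      have := ((mem_down.1 hκ).rowLen_le 0).1
      omega

/-! ### The weighted sum along the walk -/

theorem sum_level_up (n : ℕ) (F : YoungDiagram → YoungDiagram → ℕ) :
    ∑ μ ∈ level n, ∑ ν ∈ up μ, F μ ν = ∑ ν ∈ level (n + 1), ∑ μ ∈ down ν, F μ ν := by
  refine Finset.sum_comm' fun μ ν => ?_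
  simp only [mem_level, mem_up, mem_down]
  constructor
  · rintro ⟨h1, h2⟩
    exact ⟨h2, by rw [h2.2, h1]⟩
  · rintro ⟨h1, h2⟩
    have := h1.2
    exact ⟨by omega, h1⟩

/-- Summing over cover pairs from the top shape `ν` collects `∑ f^μ` over `down ν`, which is `f^ν`
by branching. -/
theorem sum_numSYT_mul_numVac_removal (n k : ℕ) :
    ∑ μ ∈ level n, numSYT μ * numVac (n + 1) (2 * k + 1) μ =
      ∑ ν ∈ level (n + 1), numSYT ν * numVac (n + 1) (2 * k) ν := by
  simp only [numVac_succ_of_even (even_two_mul k), Finset.mul_sum]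
  rw [sum_level_up]
  refine Finset.sum_congr rfl fun ν hν => ?_
  rw [← Finset.sum_mul, ← numSYT_eq_sum_down ν (by rw [mem_level.1 hν]; omega)]

/-- Summing over cover pairs from the bottom shape `μ` collects `∑ f^ν` over `up μ`, whence the
factor `n + 1`. -/
theorem sum_numSYT_mul_numVac_insertion (n k : ℕ) :
    ∑ ν ∈ level (n + 1), numSYT ν * numVac (n + 1) (2 * (k + 1)) ν =
      (n + 1) * ∑ μ ∈ level n, numSYT μ * numVac (n + 1) (2 * k + 1) μ := by
  rw [show 2 * (k + 1) = 2 * k + 1 + 1 by ring]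
  simp only [numVac_succ_of_odd (odd_two_mul_add_one k), Finset.mul_sum]
  rw [← sum_level_up n fun μ ν => numSYT ν * numVac (n + 1) (2 * k + 1) μ]
  refine Finset.sum_congr rfl fun μ hμ => ?_
  rw [← Finset.sum_mul, sum_up_numSYT, mem_level.1 hμ, mul_assoc]

theorem sum_level_numSYT_mul_numVac (n k : ℕ) :
    ∑ ν ∈ level (n + 1), numSYT ν * numVac (n + 1) (2 * k) ν = (n + 1) ^ k := by
  induction k with
  | zero =>
    rw [Finset.sum_eq_single_of_mem (oneRow (n + 1)) (mem_level.2 (card_oneRow _))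
      fun ν _ hne => by rw [mul_zero, numVac_zero_of_ne hne, mul_zero]]
    rw [mul_zero, numVac_zero_oneRow, numSYT_oneRow, pow_zero, one_mul]
  | succ k ih =>
    rw [sum_numSYT_mul_numVac_insertion, sum_numSYT_mul_numVac_removal, ih, pow_succ']

end Vacillating

theorem mainTheorem11 (n k : ℕ) (hn : 1 ≤ n) :
    n ^ k = ∑ μ ∈ Vacillating.shapes (n - 1) k,
      Vacillating.numSYT μ * Vacillating.numVac n (2 * k + 1) μ := by
  obtain ⟨n, rfl⟩ := Nat.exists_eq_add_of_le' hn
  rw [Nat.add_sub_cancel, ← Vacillating.sum_level_numSYT_mul_numVac,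
    ← Vacillating.sum_numSYT_mul_numVac_removal]
  symm
  refine Finset.sum_subset (fun μ hμ => ?_) fun μ hμ hμ' => ?_
  · have h : μ ∈ Vacillating.shapeSet n k := (Set.Finite.mem_toFinset _).1 hμ
    exact Vacillating.mem_level.2 h.1
  · have h : μ ∉ Vacillating.shapeSet n k := fun h => hμ' ((Set.Finite.mem_toFinset _).2 h)
    -- With `n + 1` in place of the original `n`, there are `k + 1` removals, so the count vanishes
    -- when `μ₁ + (k + 1) < n + 1`, which is `μ₁ < n - k` over the integers.
    rw [Vacillating.numVac_eq_zero_of_rowLen_lt, mul_zero]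
    by_contra hlt
    refine h ⟨Vacillating.mem_level.1 hμ, ?_⟩
    omega
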